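/- Let $d\ge 1$ and let $\alpha=(\alpha_1,\dots,\alpha_d)\in\mathbb{R}^d$ be such that $1,\alpha_1,\dots,\alpha_d$ are linearly independent over $\mathbb{Q}$. Write $\operatorname{mes}$ for Lebesgue measure on $\mathbb{R}^d$. A bounded set $S\subset\mathbb{R}^d$ is called Riemann measurable if its boundary has measure zero. A measurable set $S\subset\mathbb{R}^d$ of finite measure is called a bounded remainder set (with respect to $\alpha$) if there is a constant $C=C(S,\alpha)$ such that, for every $n\ge 0$ and almost every $x\in\mathbb{R}^d$, $$\Big|\sum_{k=0}^{n-1}\chi_S(x+k\alpha)-n\operatorname{mes}S\Big|\le C,\qquad\text{where}\quad \chi_S(x)=\sum_{m\in\mathbb{Z}^d}\mathbf{1}_S(x+m).$$ Let $\gamma$ be a positive number of the form $\gamma=n_0+n_1\alpha_1+\cdots+n_d\alpha_d$ with integers $n_0,\dots,n_d$. Suppose that $U\subset\mathbb{R}^d$ is open, $K\subset U$ is compact, and $\operatorname{mes}K<\gamma<\operatorname{mes}U$ (where $\operatorname{mes}U=\infty$ is allowed). Then there exists a Riemann measurable bounded remainder set $S$ with $K\subset S\subset U$ and $\operatorname{mes}S=\gamma$.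 -/

import Mathlib

open MeasureTheory

namespace BoundedRemainder

noncomputable section

/-- A bounded subset of `ℝ^d` is Riemann measurable if its boundary has Lebesgue measure zero. -/
def IsRiemannMeasurable {d : ℕ} (S : Set (Fin d → ℝ)) : Prop :=
  Bornology.IsBounded S ∧ volume (frontier S) = 0

/-- The multiplicity function `χ_S(x) = ∑_{k ∈ ℤ^d} 1_S(x + k)` of the projection of `S` to the
torus `ℝ^d / ℤ^d`. (For a measurable set of finite measure the sum is finite for almost
every `x`; for a bounded set it is finite for every `x`.) -/
def torusMultiplicity {d : ℕ} (S : Set (Fin d → ℝ)) (x : Fin d → ℝ) : ℝ :=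
  ∑' k : Fin d → ℤ, S.indicator (fun _ => (1 : ℝ)) (x + fun i => (k i : ℝ))

/-- The discrepancy `D_n(S, x) = ∑_{k=0}^{n-1} χ_S(x + kα) - n mes S`. -/
def discrepancy {d : ℕ} (α : Fin d → ℝ) (S : Set (Fin d → ℝ)) (n : ℕ) (x : Fin d → ℝ) : ℝ :=
  (∑ k ∈ Finset.range n, torusMultiplicity S (x + (k : ℝ) • α)) - n * (volume S).toReal

/-- `S` is a bounded remainder set with respect to `α`: a (Lebesgue measurable) set of finite
measure whose discrepancy is bounded by a constant that depends neither on `n` nor on `x`,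
for every `n` and almost every `x`. -/
def IsBoundedRemainderSet {d : ℕ} (α : Fin d → ℝ) (S : Set (Fin d → ℝ)) : Prop :=
  NullMeasurableSet S ∧ volume S ≠ ⊤ ∧
    ∃ C : ℝ, ∀ n : ℕ, ∀ᵐ x : Fin d → ℝ, |discrepancy α S n x| ≤ C

end

end BoundedRemainder

/-! Translating a bounded set by an element of `ℤ α + ℤ^d` changes its visit counts only by a
bounded amount, and this group is dense by Kronecker's theorem. So a Riemann measurable set can be
cut into small pieces that are moved, without overlap, into any open set of larger volume
(`exists_equidiscrepant_subset`); volume is kept, and visit counts up to a bounded error. A model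
set `T` of volume `γ` with bounded discrepancy is explicit: `⌊γ⌋` unit cubes together with a strip
of another unit cube, on which the discrepancy telescopes (`exists_visits_sub_le`). Now choose a
Riemann measurable `A ⊇ K` with closure in `U` and volume below `γ`. Move `A` to some `A'` inside
`T`, then move the remainder `T \ A'` to some `R` inside `U \ closure A`. The set `S = A ∪ R` is a
rearrangement of `T`, so it inherits the volume and the bounded discrepancy. -/

namespace BoundedRemainder

noncomputable section

/-! ### Kronecker's theorem by Fourier series on the torus -/

section Density

-- `mFourierCoeff` integrates against normalised Haar measure; `volume` must be that measure for it
-- to unfold by `rfl`.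
local instance : MeasureSpace UnitAddCircle := ⟨AddCircle.haarAddCircle⟩

local instance : Measure.IsAddHaarMeasure (volume : Measure UnitAddCircle) :=
  inferInstanceAs (Measure.IsAddHaarMeasure AddCircle.haarAddCircle)

local instance : IsProbabilityMeasure (volume : Measure UnitAddCircle) :=
  inferInstanceAs (IsProbabilityMeasure AddCircle.haarAddCircle)

open UnitAddTorus

lemma mFourier_add_point {d : ℕ} (n : Fin d → ℤ) (x y : UnitAddTorus (Fin d)) :
    mFourier n (x + y) = mFourier n x * mFourier n y := by
  simp [mFourier, fourier_apply, smul_add, AddCircle.toCircle_add, Finset.prod_mul_distrib]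

/-- Substituting `t + a` for `t` multiplies the coefficient by `mFourier (-n) a`, which differs from
1. -/
lemma mFourierCoeff_eq_zero_of_invariant {d : ℕ} (f : UnitAddTorus (Fin d) → ℂ)
    (a : UnitAddTorus (Fin d)) (hf : ∀ x, f (x + a) = f x) (n : Fin d → ℤ)
    (hn : mFourier n a ≠ 1) : mFourierCoeff f n = 0 := by
  have hna : mFourier (-n) a ≠ 1 := by
    rw [mFourier_neg]
    intro h
    apply hn
    have := congrArg (starRingEnd ℂ) h
    simpa using this
  have h : mFourierCoeff f n = mFourier (-n) a * mFourierCoeff f n := by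
    calc mFourierCoeff f n = ∫ t, mFourier (-n) t • f t := rfl
      _ = ∫ t, mFourier (-n) (t + a) • f (t + a) :=
          (integral_add_right_eq_self (μ := (volume : Measure (UnitAddTorus (Fin d))))
            (fun t => mFourier (-n) t • f t) a).symm
      _ = ∫ t, mFourier (-n) a * (mFourier (-n) t • f t) := by
          congr 1
          ext t
          rw [hf, mFourier_add_point]
          simp only [smul_eq_mul]
          ring
      _ = mFourier (-n) a * mFourierCoeff f n := integral_const_mul _ _
  have h2 : (mFourier (-n) a - 1) * mFourierCoeff f n = 0 := by linear_combination -h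
  exact (mul_eq_zero.1 h2).resolve_left (sub_ne_zero.2 hna)

/-- Only the coefficient at 0 survives, so the Fourier series is summable and recovers the
continuous function as a constant. -/
lemma eq_of_invariant {d : ℕ} (f : C(UnitAddTorus (Fin d), ℂ))
    (a : UnitAddTorus (Fin d)) (hf : ∀ x, f (x + a) = f x)
    (ha : ∀ n : Fin d → ℤ, n ≠ 0 → mFourier n a ≠ 1) (x y : UnitAddTorus (Fin d)) :
    f x = f y := by
  have h0 : ∀ n : Fin d → ℤ, n ≠ 0 → mFourierCoeff f n = 0 := fun n hn =>
    mFourierCoeff_eq_zero_of_invariant f a hf n (ha n hn)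
  have hs : Summable (mFourierCoeff f) :=
    summable_of_ne_finset_zero (s := {0}) fun n hn => h0 n (by simpa using hn)
  have key : ∀ z, f z = mFourierCoeff f 0 := by
    intro z
    have h1 := hasSum_mFourier_series_apply_of_summable hs z
    have h2 := hasSum_single (f := fun i => mFourierCoeff f i • mFourier i z) 0
      fun n hn => by simp [h0 n hn]
    rw [h1.unique h2]
    simp [mFourier_zero]
  rw [key x, key y]

end Density

open UnitAddTorus

lemma int_eq_zero_of_linearIndependent {d : ℕ} {α : Fin d → ℝ}
    (hα : LinearIndependent ℚ (Fin.cons 1 α : Fin (d + 1) → ℝ)) (m : ℤ) (n : Fin d → ℤ)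
    (h : ∑ i, (n i : ℝ) * α i = m) : n = 0 := by
  have := Fintype.linearIndependent_iff.1 hα (Fin.cons (-(m : ℚ)) fun i => (n i : ℚ)) (by
    rw [Fin.sum_univ_succ]
    simp only [Fin.cons_zero, Fin.cons_succ, Rat.smul_def]
    push_cast
    rw [h]
    ring)
  ext i
  have h2 := this i.succ
  simpa using h2

lemma mFourier_ne_one {d : ℕ} {α : Fin d → ℝ}
    (hα : LinearIndependent ℚ (Fin.cons 1 α : Fin (d + 1) → ℝ)) (n : Fin d → ℤ) (hn : n ≠ 0) :
    mFourier n (fun i => (α i : UnitAddCircle)) ≠ 1 := by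
  intro h
  have h1 : mFourier n (fun i => (α i : UnitAddCircle)) =
      Complex.exp (((∑ i, (n i : ℝ) * α i : ℝ) : ℂ) * (2 * Real.pi * Complex.I)) := by
    simp only [mFourier, ContinuousMap.coe_mk, fourier_coe_apply]
    rw [← Complex.exp_sum]
    congr 1
    push_cast
    rw [Finset.sum_mul]
    refine Finset.sum_congr rfl fun i _ => ?_
    simp
    ring
  rw [h1, Complex.exp_eq_one_iff] at h
  obtain ⟨m, hm⟩ := h
  have h2 := mul_right_cancel₀ Complex.two_pi_I_ne_zero hm
  exact hn (int_eq_zero_of_linearIndependent hα m n (by exact_mod_cast h2))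

/-- The distance to the subgroup generated by `a` is continuous and invariant under `a`, hence
constant; it vanishes at 0. -/
lemma exists_zsmul_near {d : ℕ} (a : UnitAddTorus (Fin d))
    (ha : ∀ n : Fin d → ℤ, n ≠ 0 → mFourier n a ≠ 1) (b : UnitAddTorus (Fin d)) {ε : ℝ}
    (hε : 0 < ε) : ∃ q : ℤ, dist b (q • a) < ε := by
  obtain ⟨Z, hZ⟩ : ∃ Z : Set (UnitAddTorus (Fin d)), Z = AddSubgroup.zmultiples a := ⟨_, rfl⟩
  have hmem : ∀ z, z ∈ Z ↔ ∃ q : ℤ, q • a = z := fun z => by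
    rw [hZ, SetLike.mem_coe, AddSubgroup.mem_zmultiples_iff]
  have hcont : Continuous fun x => ((Metric.infDist x Z : ℝ) : ℂ) :=
    Complex.continuous_ofReal.comp (Metric.continuous_infDist_pt _)
  have h0 : (0 : UnitAddTorus (Fin d)) ∈ Z := (hmem _).2 ⟨0, zero_smul _ _⟩
  have hinv : ∀ x, Metric.infDist (x + a) Z = Metric.infDist x Z := by
    intro x
    have himg : (fun z => z + a) '' Z = Z := by
      ext z
      constructor
      · rintro ⟨w, hw, rfl⟩
        obtain ⟨q, rfl⟩ := (hmem _).1 hw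
        exact (hmem _).2 ⟨q + 1, add_one_zsmul _ _⟩
      · intro hz
        obtain ⟨q, rfl⟩ := (hmem _).1 hz
        exact ⟨(q - 1) • a, (hmem _).2 ⟨q - 1, rfl⟩, by
          change (q - 1) • a + a = q • a
          rw [← add_one_zsmul, sub_add_cancel]⟩
    have := Metric.infDist_image (Φ := fun z => z + a) (isometry_add_right a) (x := x) (t := Z)
    rwa [himg] at this
  have hb := eq_of_invariant ⟨_, hcont⟩ a
    (fun x => congrArg (fun r : ℝ => (r : ℂ)) (hinv x)) ha b 0
  have hb1 : Metric.infDist b Z = Metric.infDist 0 Z := Complex.ofReal_injective hb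
  rw [Metric.infDist_zero_of_mem h0] at hb1
  obtain ⟨z, hz, hd⟩ := (Metric.infDist_lt_iff ⟨0, h0⟩).1 (hb1.trans_lt hε)
  obtain ⟨q, rfl⟩ := (hmem _).1 hz
  exact ⟨q, hd⟩

/-- **Kronecker's theorem**: the group generated by `α` and `ℤ^d` is dense in `ℝ^d`. -/
theorem exists_int_near {d : ℕ} {α : Fin d → ℝ}
    (hα : LinearIndependent ℚ (Fin.cons 1 α : Fin (d + 1) → ℝ)) (y : Fin d → ℝ) {ε : ℝ}
    (hε : 0 < ε) : ∃ (q : ℤ) (m : Fin d → ℤ), ∀ i, |q * α i + m i - y i| < ε := by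
  obtain ⟨q, hq⟩ := exists_zsmul_near _ (mFourier_ne_one hα) (fun i => (y i : UnitAddCircle)) hε
  refine ⟨q, fun i => -round (q * α i - y i), fun i => ?_⟩
  have h1 := (dist_le_pi_dist _ _ i).trans_lt hq
  have h2 : q • (α i : UnitAddCircle) - (y i : UnitAddCircle) =
      ((q * α i - y i : ℝ) : UnitAddCircle) := by
    rw [← zsmul_eq_mul, AddCircle.coe_sub, AddCircle.coe_zsmul]
  rw [dist_comm, dist_eq_norm, Pi.smul_apply, h2, UnitAddCircle.norm_eq] at h1
  have h3 : q * α i + ((-round (q * α i - y i) : ℤ) : ℝ) - y i =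
      q * α i - y i - round (q * α i - y i) := by
    push_cast
    ring
  rw [h3]
  exact h1

variable {d : ℕ} {α : Fin d → ℝ} {A B A' B' : Set (Fin d → ℝ)}

/-! ### Riemann measurable sets -/

namespace IsRiemannMeasurable

lemma nullMeasurableSet (hA : IsRiemannMeasurable A) : NullMeasurableSet A :=
  nullMeasurableSet_of_null_frontier hA.2

lemma volume_ne_top (hA : IsRiemannMeasurable A) : volume A ≠ ⊤ := hA.1.measure_lt_top.ne

lemma empty : IsRiemannMeasurable (∅ : Set (Fin d → ℝ)) := ⟨Bornology.isBounded_empty, by simp⟩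

lemma union (hA : IsRiemannMeasurable A) (hB : IsRiemannMeasurable B) :
    IsRiemannMeasurable (A ∪ B) := by
  refine ⟨hA.1.union hB.1, measure_mono_null (t := frontier A ∪ frontier B) ?_
    (measure_union_null hA.2 hB.2)⟩
  refine (frontier_union_subset A B).trans (Set.union_subset_union ?_ ?_)
  · exact Set.inter_subset_left
  · exact Set.inter_subset_right

lemma inter_of_null (hA : IsRiemannMeasurable A) (hB : volume (frontier B) = 0) :
    IsRiemannMeasurable (A ∩ B) :=
  ⟨hA.1.subset Set.inter_subset_left, null_frontier_inter hA.2 hB⟩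

lemma diff (hA : IsRiemannMeasurable A) (hB : IsRiemannMeasurable B) :
    IsRiemannMeasurable (A \ B) := by
  rw [Set.sdiff_eq]
  exact hA.inter_of_null (by rw [frontier_compl]; exact hB.2)

lemma biUnion {ι : Type*} (I : Finset ι) {A : ι → Set (Fin d → ℝ)}
    (hA : ∀ i ∈ I, IsRiemannMeasurable (A i)) : IsRiemannMeasurable (⋃ i ∈ I, A i) := by
  classical
  induction I using Finset.induction_on with
  | empty => simpa using empty
  | insert i I _ ih =>
    rw [Finset.set_biUnion_insert]
    exact (hA i (Finset.mem_insert_self _ _)).union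
      (ih fun j hj => hA j (Finset.mem_insert_of_mem hj))

lemma volume_closure (hA : IsRiemannMeasurable A) : volume (closure A) = volume A :=
  le_antisymm (by
    rw [closure_eq_self_union_frontier]
    exact (measure_union_le _ _).trans (by rw [hA.2, add_zero])) (measure_mono subset_closure)

lemma volume_interior (hA : IsRiemannMeasurable A) : volume (interior A) = volume A :=
  le_antisymm (measure_mono interior_subset) (by
    calc volume A ≤ volume (interior A ∪ frontier A) :=
          measure_mono (subset_closure.trans (closure_eq_interior_union_frontier A).subset)
      _ ≤ volume (interior A) := (measure_union_le _ _).trans (by rw [hA.2, add_zero]))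

lemma preimage_add (hA : IsRiemannMeasurable A) (w : Fin d → ℝ) :
    IsRiemannMeasurable ((fun x => x + w) ⁻¹' A) := by
  constructor
  · exact (isometry_add_right w).antilipschitz.isBounded_preimage hA.1
  · have := (Homeomorph.addRight w).preimage_frontier A
    simp only [Homeomorph.coe_addRight] at this
    rw [← this, measure_preimage_add_right, hA.2]

end IsRiemannMeasurable

/-! ### Multiplicities and visit counts -/

/-- The number of integer translates that meet a bounded set is uniformly bounded. -/
lemma exists_finset_translates (hA : Bornology.IsBounded A) :
    ∃ M : ℕ, ∀ x : Fin d → ℝ, ∃ F : Finset (Fin d → ℤ), F.card ≤ M ∧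
      ∀ k ∉ F, (x + fun i => (k i : ℝ)) ∉ A := by
  obtain ⟨R, hR⟩ := hA.subset_closedBall 0
  obtain ⟨N, hN⟩ := exists_nat_ge R
  refine ⟨(2 * N + 1) ^ d, fun x => ⟨Fintype.piFinset fun i =>
    Finset.Icc ⌈-(N : ℝ) - x i⌉ ⌊(N : ℝ) - x i⌋, ?_, ?_⟩⟩
  · rw [Fintype.card_piFinset]
    calc _ ≤ ∏ _i : Fin d, (2 * N + 1) := by
          refine Finset.prod_le_prod' fun i _ => ?_
          rw [Int.card_Icc]
          have h1 := Int.le_ceil (-(N : ℝ) - x i)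
          have h2 := Int.floor_le ((N : ℝ) - x i)
          have h3 : ((⌊(N : ℝ) - x i⌋ - ⌈-(N : ℝ) - x i⌉ : ℤ) : ℝ) ≤ ((2 * N : ℤ) : ℝ) := by
            push_cast
            linarith
          have h4 : ⌊(N : ℝ) - x i⌋ - ⌈-(N : ℝ) - x i⌉ ≤ 2 * N := by exact_mod_cast h3
          omega
      _ = _ := by simp
  · intro k hk hmem
    apply hk
    have h := mem_closedBall_zero_iff.1 (hR hmem)
    rw [pi_norm_le_iff_of_nonneg ((norm_nonneg _).trans h)] at h
    rw [Fintype.mem_piFinset]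
    intro i
    have hi := abs_le.1 ((h i).trans hN)
    simp only [Pi.add_apply] at hi
    rw [Finset.mem_Icc, Int.ceil_le, Int.le_floor]
    constructor <;> linarith

lemma torusMultiplicity_eq_sum {x : Fin d → ℝ} {F : Finset (Fin d → ℤ)}
    (hF : ∀ k ∉ F, (x + fun i => (k i : ℝ)) ∉ A) :
    torusMultiplicity A x =
      ∑ k ∈ F, A.indicator (fun _ => (1 : ℝ)) (x + fun i => (k i : ℝ)) :=
  tsum_eq_sum fun k hk => Set.indicator_of_notMem (hF k hk) _

lemma exists_torusMultiplicity_le (hA : Bornology.IsBounded A) :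
    ∃ M : ℕ, ∀ x : Fin d → ℝ, torusMultiplicity A x ∈ Set.Icc (0 : ℝ) M := by
  obtain ⟨M, hM⟩ := exists_finset_translates hA
  refine ⟨M, fun x => ?_⟩
  obtain ⟨F, hc, hF⟩ := hM x
  rw [torusMultiplicity_eq_sum hF]
  constructor
  · exact Finset.sum_nonneg fun k _ => Set.indicator_nonneg (fun _ _ => zero_le_one) _
  · calc _ ≤ ∑ _k ∈ F, (1 : ℝ) :=
          Finset.sum_le_sum fun k _ => Set.indicator_le_self' (fun _ _ => zero_le_one) _
      _ ≤ M := by simpa using hc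

lemma torusMultiplicity_union (hA : Bornology.IsBounded A) (hB : Bornology.IsBounded B)
    (h : Disjoint A B) (x : Fin d → ℝ) :
    torusMultiplicity (A ∪ B) x = torusMultiplicity A x + torusMultiplicity B x := by
  classical
  obtain ⟨_, hM⟩ := exists_finset_translates (hA.union hB)
  obtain ⟨F, -, hF⟩ := hM x
  rw [torusMultiplicity_eq_sum hF, torusMultiplicity_eq_sum fun k hk hx => hF k hk (Or.inl hx),
    torusMultiplicity_eq_sum fun k hk hx => hF k hk (Or.inr hx), ← Finset.sum_add_distrib]
  refine Finset.sum_congr rfl fun k _ => ?_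
  rw [Set.indicator_union_of_disjoint h]

lemma torusMultiplicity_preimage_add (A : Set (Fin d → ℝ)) (w x : Fin d → ℝ) :
    torusMultiplicity ((fun x => x + w) ⁻¹' A) x = torusMultiplicity A (x + w) := by
  unfold torusMultiplicity
  refine tsum_congr fun k => ?_
  rw [add_right_comm x w]
  rfl

lemma torusMultiplicity_add_int (A : Set (Fin d → ℝ)) (x : Fin d → ℝ) (m : Fin d → ℤ) :
    torusMultiplicity A (x + fun i => (m i : ℝ)) = torusMultiplicity A x := by
  unfold torusMultiplicity
  conv_rhs => rw [← (Equiv.addLeft m).tsum_eq]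
  refine tsum_congr fun k => ?_
  congr 1
  ext i
  simp [add_assoc]

/-- The number of visits of the first `n` points of the orbit of `x` to the projection of `A`. -/
def visits (α : Fin d → ℝ) (A : Set (Fin d → ℝ)) (n : ℕ) (x : Fin d → ℝ) : ℝ :=
  ∑ k ∈ Finset.range n, torusMultiplicity A (x + (k : ℝ) • α)

lemma visits_union (hA : Bornology.IsBounded A) (hB : Bornology.IsBounded B)
    (h : Disjoint A B) (n : ℕ) (x : Fin d → ℝ) :
    visits α (A ∪ B) n x = visits α A n x + visits α B n x := by
  simp only [visits, torusMultiplicity_union hA hB h, Finset.sum_add_distrib]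

lemma visits_add_int (n : ℕ) (x : Fin d → ℝ) (m : Fin d → ℤ) :
    visits α A n (x + fun i => (m i : ℝ)) = visits α A n x := by
  unfold visits
  refine Finset.sum_congr rfl fun k _ => ?_
  rw [add_right_comm, torusMultiplicity_add_int]

/-- An orbit segment of length `n + q` can be split after `q` or after `n` steps. The right-hand
side has only `q` terms in each sum, which gives bounds uniform in `n`. -/
lemma visits_add_smul_sub (n q : ℕ) (x : Fin d → ℝ) :
    visits α A n (x + (q : ℝ) • α) - visits α A n x =
      visits α A q (x + (n : ℝ) • α) - visits α A q x := by
  have h : ∀ n q : ℕ, visits α A (q + n) x = visits α A q x + visits α A n (x + (q : ℝ) • α) := by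
    intro n q
    unfold visits
    rw [Finset.sum_range_add]
    congr 1
    refine Finset.sum_congr rfl fun k _ => ?_
    rw [add_assoc, ← add_smul, Nat.cast_add]
  have h1 := h n q
  have h2 := h q n
  rw [add_comm n q] at h2
  linarith

lemma visits_mem_Icc {M : ℕ} (hM : ∀ x : Fin d → ℝ, torusMultiplicity A x ∈ Set.Icc (0 : ℝ) M)
    (n : ℕ) (x : Fin d → ℝ) : visits α A n x ∈ Set.Icc (0 : ℝ) (n * M) := by
  unfold visits
  constructor
  · exact Finset.sum_nonneg fun k _ => (hM _).1
  · calc _ ≤ ∑ _k ∈ Finset.range n, (M : ℝ) := Finset.sum_le_sum fun k _ => (hM _).2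
      _ = _ := by simp

lemma exists_abs_visits_add_sub_le (hA : Bornology.IsBounded A) (q : ℤ) (m : Fin d → ℤ) :
    ∃ C : ℝ, ∀ n x,
      |visits α A n x - visits α A n (x + ((q : ℝ) • α + fun i => (m i : ℝ)))| ≤ C := by
  obtain ⟨M, hM⟩ := exists_torusMultiplicity_le hA
  have key : ∀ (n p : ℕ) (x : Fin d → ℝ),
      |visits α A n (x + (p : ℝ) • α) - visits α A n x| ≤ p * M := by
    intro n p x
    rw [visits_add_smul_sub]
    have h1 := visits_mem_Icc (α := α) hM p x
    have h2 := visits_mem_Icc (α := α) hM p (x + (n : ℝ) • α)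
    rw [abs_le]
    constructor <;> linarith [h1.1, h1.2, h2.1, h2.2]
  obtain ⟨p, rfl | rfl⟩ := q.eq_nat_or_neg
  · refine ⟨p * M, fun n x => ?_⟩
    rw [← add_assoc, visits_add_int, abs_sub_comm]
    exact_mod_cast key n p x
  · refine ⟨p * M, fun n x => ?_⟩
    rw [← add_assoc, visits_add_int]
    -- For a negative shift, start at the shifted point and move forward to `x`.
    have := key n p (x + ((-(p : ℤ) : ℤ) : ℝ) • α)
    rw [add_assoc, ← add_smul] at this
    simpa using this

/-! ### Rearrangement with bounded change in visits -/

/-- Two Riemann measurable sets of the same volume whose numbers of visits differ by a bounded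
amount. -/
structure Equidiscrepant (α : Fin d → ℝ) (A B : Set (Fin d → ℝ)) : Prop where
  left : IsRiemannMeasurable A
  right : IsRiemannMeasurable B
  volume_eq : volume A = volume B
  bounded : ∃ C : ℝ, ∀ n x, |visits α A n x - visits α B n x| ≤ C

namespace Equidiscrepant

lemma refl (hA : IsRiemannMeasurable A) : Equidiscrepant α A A :=
  ⟨hA, hA, rfl, 0, fun n x => by simp⟩

lemma symm (h : Equidiscrepant α A B) : Equidiscrepant α B A := by
  obtain ⟨C, hC⟩ := h.bounded
  exact ⟨h.right, h.left, h.volume_eq.symm, C, fun n x => by rw [abs_sub_comm]; exact hC n x⟩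

lemma union (h : Equidiscrepant α A B) (h' : Equidiscrepant α A' B') (hA : Disjoint A A')
    (hB : Disjoint B B') : Equidiscrepant α (A ∪ A') (B ∪ B') := by
  obtain ⟨C, hC⟩ := h.bounded
  obtain ⟨C', hC'⟩ := h'.bounded
  refine ⟨h.left.union h'.left, h.right.union h'.right, ?_, C + C', fun n x => ?_⟩
  · rw [measure_union₀ h'.left.nullMeasurableSet hA.aedisjoint,
      measure_union₀ h'.right.nullMeasurableSet hB.aedisjoint, h.volume_eq, h'.volume_eq]
  · rw [visits_union h.left.1 h'.left.1 hA, visits_union h.right.1 h'.right.1 hB, add_sub_add_comm]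
    exact (abs_add_le _ _).trans (add_le_add (hC n x) (hC' n x))

lemma biUnion {ι : Type*} (I : Finset ι) {A B : ι → Set (Fin d → ℝ)}
    (h : ∀ i ∈ I, Equidiscrepant α (A i) (B i))
    (hA : (I : Set ι).PairwiseDisjoint A) (hB : (I : Set ι).PairwiseDisjoint B) :
    Equidiscrepant α (⋃ i ∈ I, A i) (⋃ i ∈ I, B i) := by
  classical
  induction I using Finset.induction_on with
  | empty => simpa using refl IsRiemannMeasurable.empty
  | insert i I hi ih =>
    rw [Finset.set_biUnion_insert, Finset.set_biUnion_insert]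
    rw [Finset.coe_insert] at hA hB
    have hdisj : ∀ {D : ι → Set (Fin d → ℝ)}, (insert i (I : Set ι)).PairwiseDisjoint D →
        Disjoint (D i) (⋃ j ∈ I, D j) := by
      intro D hD
      rw [Set.disjoint_iUnion₂_right]
      intro j hj
      exact hD (Set.mem_insert _ _) (Set.mem_insert_of_mem _ hj) (by rintro rfl; exact hi hj)
    exact (h i (Finset.mem_insert_self _ _)).union
      (ih (fun j hj => h j (Finset.mem_insert_of_mem hj)) (hA.subset (Set.subset_insert _ _))
        (hB.subset (Set.subset_insert _ _))) (hdisj hA) (hdisj hB)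

lemma preimage_add (hA : IsRiemannMeasurable A) (q : ℤ) (m : Fin d → ℤ) :
    Equidiscrepant α A ((fun x => x + ((q : ℝ) • α + fun i => (m i : ℝ))) ⁻¹' A) := by
  refine ⟨hA, hA.preimage_add _, (measure_preimage_add_right _ _ _).symm, ?_⟩
  obtain ⟨C, hC⟩ := exists_abs_visits_add_sub_le (α := α) hA.1 q m
  refine ⟨C, fun n x => ?_⟩
  convert hC n x using 3
  unfold visits
  refine Finset.sum_congr rfl fun k _ => ?_
  rw [torusMultiplicity_preimage_add, add_right_comm]

end Equidiscrepant

/-- A set that shares its number of visits, up to a bounded error, with a set whose number of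
visits is `n * γ` up to a bounded error is a bounded remainder set. -/
lemma Equidiscrepant.isBoundedRemainderSet {T S : Set (Fin d → ℝ)} (h : Equidiscrepant α T S)
    {C : ℝ} (hT : ∀ n x, |visits α T n x - n * (volume T).toReal| ≤ C) :
    IsBoundedRemainderSet α S := by
  refine ⟨h.right.nullMeasurableSet, h.right.volume_ne_top, ?_⟩
  obtain ⟨C', hC'⟩ := h.symm.bounded
  refine ⟨C' + C, fun n => Filter.Eventually.of_forall fun x => ?_⟩
  rw [discrepancy, ← h.volume_eq]
  exact (abs_sub_le _ (visits α T n x) _).trans (add_le_add (hC' n x) (hT n x))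

/-! ### Grid cubes and rearrangement into an open set -/

/-- The half-open cube of side `ε` in the grid `ε ℤ^d` with index `k`. -/
def gridCube (ε : ℝ) (k : Fin d → ℤ) : Set (Fin d → ℝ) := {x | ∀ i, ⌊x i / ε⌋ = k i}

lemma mem_gridCube {ε : ℝ} (hε : 0 < ε) {k : Fin d → ℤ} {x : Fin d → ℝ} :
    x ∈ gridCube ε k ↔ ∀ i, x i ∈ Set.Ico (ε * k i) (ε * k i + ε) := by
  refine forall_congr' fun i => ?_
  rw [Int.floor_eq_iff, le_div_iff₀ hε, div_lt_iff₀ hε, Set.mem_Ico]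
  ring_nf

lemma gridCube_eq_pi {ε : ℝ} (hε : 0 < ε) (k : Fin d → ℤ) :
    gridCube ε k = Set.univ.pi fun i => Set.Ico (ε * k i) (ε * k i + ε) := by
  ext x
  rw [mem_gridCube hε, Set.mem_univ_pi]

lemma pairwise_disjoint_gridCube (ε : ℝ) :
    Pairwise (Function.onFun Disjoint (gridCube ε : (Fin d → ℤ) → Set (Fin d → ℝ))) := by
  intro k l hkl
  refine Set.disjoint_left.2 fun x hk hl => hkl (funext fun i => ?_)
  rw [← hk i, ← hl i]

lemma volume_gridCube {ε : ℝ} (hε : 0 < ε) (k : Fin d → ℤ) :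
    volume (gridCube ε k) = ENNReal.ofReal (ε ^ d) := by
  rw [gridCube_eq_pi hε, Real.volume_pi_Ico]
  simp [ENNReal.ofReal_pow hε.le]

lemma isRiemannMeasurable_gridCube {ε : ℝ} (hε : 0 < ε) (k : Fin d → ℤ) :
    IsRiemannMeasurable (gridCube ε k) := by
  rw [gridCube_eq_pi hε]
  exact ⟨Bornology.IsBounded.pi fun i => Metric.isBounded_Ico _ _,
    (convex_pi fun i _ => convex_Ico _ _).addHaar_frontier _⟩

lemma volume_biUnion_gridCube {ε : ℝ} (hε : 0 < ε) (I : Finset (Fin d → ℤ)) :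
    volume (⋃ k ∈ I, gridCube ε k) = ENNReal.ofReal (I.card * ε ^ d) := by
  rw [measure_biUnion_finset₀ (fun k _ l _ h => (pairwise_disjoint_gridCube ε h).aedisjoint)
    fun k _ => (isRiemannMeasurable_gridCube hε k).nullMeasurableSet]
  simp [volume_gridCube hε, ENNReal.ofReal_mul]

lemma dist_le_of_mem_gridCube {ε : ℝ} (hε : 0 < ε) {k : Fin d → ℤ} {x y : Fin d → ℝ}
    (hx : x ∈ gridCube ε k) (hy : y ∈ gridCube ε k) : dist x y ≤ ε := by
  rw [mem_gridCube hε] at hx hy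
  refine (dist_pi_le_iff hε.le).2 fun i => ?_
  rw [Real.dist_eq, abs_le]
  constructor <;> linarith [(hx i).1, (hx i).2, (hy i).1, (hy i).2]

/-- A compact subset of an open set is covered by finitely many cubes of any sufficiently fine grid
that lie in the open set. -/
lemma exists_gridCube_cover {K W : Set (Fin d → ℝ)} (hK : IsCompact K) (hW : IsOpen W)
    (hKW : K ⊆ W) : ∃ δ > 0, ∀ ε, 0 < ε → ε < δ → ∃ I : Finset (Fin d → ℤ),
      K ⊆ ⋃ k ∈ I, gridCube ε k ∧ ∀ k ∈ I, gridCube ε k ⊆ W := by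
  classical
  obtain ⟨δ, hδ, hsub⟩ := hK.exists_thickening_subset_open hW hKW
  refine ⟨δ, hδ, fun ε hε hεδ => ?_⟩
  obtain ⟨R, hR⟩ := hK.isBounded.subset_closedBall 0
  -- Only cubes meeting `K` are kept: their points are within `ε < δ` of `K`, hence in `W`. The
  -- index box makes the family finite.
  refine ⟨(Fintype.piFinset fun _ => Finset.Icc ⌊-R / ε⌋ ⌊R / ε⌋).filter
    fun k => (gridCube ε k ∩ K).Nonempty, ?_, ?_⟩
  · intro x hx
    have hxk : x ∈ gridCube ε fun i => ⌊x i / ε⌋ := fun i => rfl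
    refine Set.mem_iUnion₂.2 ⟨_, Finset.mem_filter.2 ⟨?_, x, hxk, hx⟩, hxk⟩
    rw [Fintype.mem_piFinset]
    intro i
    have h := mem_closedBall_zero_iff.1 (hR hx)
    rw [pi_norm_le_iff_of_nonneg ((norm_nonneg _).trans h)] at h
    have hi := abs_le.1 (h i)
    rw [Finset.mem_Icc]
    constructor
    · exact Int.floor_le_floor (by gcongr; exact hi.1)
    · exact Int.floor_le_floor (by gcongr; exact hi.2)
  · intro k hk
    obtain ⟨-, y, hyk, hyK⟩ := Finset.mem_filter.1 hk
    refine fun x hx => hsub (Metric.mem_thickening_iff.2 ⟨y, hyK, ?_⟩)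
    exact (dist_le_of_mem_gridCube hε hx hyk).trans_lt hεδ

/-- The strict gap in volume pays for target cubes slightly larger than the source cubes, since
translations from a dense group place a cube only approximately. -/
lemma exists_scale_gt_one {c₁ c₂ : ℝ} (h : c₁ < c₂) (d : ℕ) : ∃ t > 1, c₁ * t ^ d < c₂ := by
  have hc : Continuous fun t : ℝ => c₁ * t ^ d := by fun_prop
  have h1 : ∀ᶠ t in nhdsWithin (1 : ℝ) (Set.Ioi 1), c₁ * t ^ d < c₂ :=
    (hc.tendsto 1).eventually_lt_const (by simpa using h) |>.filter_mono nhdsWithin_le_nhds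
  obtain ⟨t, ht, ht1⟩ := (h1.and self_mem_nhdsWithin).exists
  exact ⟨t, ht1, ht⟩

/-- A grid cube can be moved by an element of the dense group `ℤ α + ℤ^d` into any larger
grid cube. -/
lemma exists_preimage_gridCube_subset
    (hα : LinearIndependent ℚ (Fin.cons 1 α : Fin (d + 1) → ℝ)) {ε η : ℝ} (hε : 0 < ε)
    (hεη : ε < η) (k l : Fin d → ℤ) : ∃ (q : ℤ) (m : Fin d → ℤ),
      (fun x => x + ((q : ℝ) • α + fun i => (m i : ℝ))) ⁻¹' gridCube ε k ⊆ gridCube η l := by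
  -- The exact target vector would centre the small cube in the large one, leaving a margin of `(η -
  -- ε) / 2` on every side.
  obtain ⟨q, m, h⟩ := exists_int_near hα (fun i => ε * k i - η * l i - (η - ε) / 2)
    (half_pos (sub_pos.2 hεη))
  refine ⟨q, m, fun x hx => ?_⟩
  rw [Set.mem_preimage, mem_gridCube hε] at hx
  rw [mem_gridCube (hε.trans hεη)]
  intro i
  have h1 := abs_lt.1 (h i)
  have h2 := hx i
  simp only [Pi.add_apply, Pi.smul_apply, smul_eq_mul, Set.mem_Ico] at h2
  constructor <;> linarith [h1.1, h1.2, h2.1, h2.2]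

/-- A Riemann measurable set can be cut into finitely many pieces that are moved by elements of
`ℤ α + ℤ^d` to disjoint positions inside any open set of larger volume. -/
theorem exists_equidiscrepant_subset
    (hα : LinearIndependent ℚ (Fin.cons 1 α : Fin (d + 1) → ℝ)) {R V : Set (Fin d → ℝ)}
    (hR : IsRiemannMeasurable R) (hV : IsOpen V) (hRV : volume R < volume V) :
    ∃ R' ⊆ V, Equidiscrepant α R R' := by
  obtain ⟨c₁, hRc, hcV⟩ := ENNReal.lt_iff_exists_nnreal_btwn.1 hRV
  obtain ⟨c₂, hc, hcV⟩ := ENNReal.lt_iff_exists_nnreal_btwn.1 hcV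
  rw [← hR.volume_closure] at hRc
  obtain ⟨W, hRW, hW, hWc⟩ := (closure R).exists_isOpen_lt_of_lt _ hRc
  obtain ⟨K, hKV, hK, hKc⟩ := hV.exists_lt_isCompact hcV
  obtain ⟨t, ht, htc⟩ := exists_scale_gt_one (NNReal.coe_lt_coe.2 (ENNReal.coe_lt_coe.1 hc)) d
  obtain ⟨δ₁, hδ₁, h₁⟩ := exists_gridCube_cover hR.1.isCompact_closure hW hRW
  obtain ⟨δ₂, hδ₂, h₂⟩ := exists_gridCube_cover hK hV hKV
  have ht0 : 0 < t := zero_lt_one.trans ht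
  obtain ⟨ε, hε, hεδ⟩ := exists_between (lt_min hδ₁ (div_pos hδ₂ ht0))
  have hεt : ε < t * ε := lt_mul_of_one_lt_left hε ht
  obtain ⟨I, hRI, hIW⟩ := h₁ ε hε (hεδ.trans_le (min_le_left _ _))
  obtain ⟨J, hKJ, hJV⟩ := h₂ (t * ε) (hε.trans hεt) (by
    have := hεδ.trans_le (min_le_right _ _)
    rw [lt_div_iff₀ ht0] at this
    linarith)
  have hI : (I.card : ℝ) * ε ^ d < c₁ := by
    have := (measure_mono (μ := volume) (Set.iUnion₂_subset hIW)).trans_lt hWc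
    rw [volume_biUnion_gridCube hε, ← ENNReal.ofReal_coe_nnreal] at this
    exact (ENNReal.ofReal_lt_ofReal_iff_of_nonneg (by positivity)).1 this
  have hJ : (c₂ : ℝ) < J.card * (t * ε) ^ d := by
    have := hKc.trans_le (measure_mono (μ := volume) hKJ)
    rw [volume_biUnion_gridCube (hε.trans hεt), ← ENNReal.ofReal_coe_nnreal] at this
    exact (ENNReal.ofReal_lt_ofReal_iff_of_nonneg c₂.2).1 this
  -- Small cubes covering `R` have total volume below `c₁`, large cubes inside `V` have total volume
  -- above `c₂`, and `c₁ * t ^ d < c₂`.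
  have hIJ : I.card ≤ J.card := by
    have h3 : (I.card : ℝ) * (t * ε) ^ d < J.card * (t * ε) ^ d := by
      calc (I.card : ℝ) * (t * ε) ^ d = I.card * ε ^ d * t ^ d := by ring
        _ ≤ c₁ * t ^ d := by gcongr
        _ < c₂ := htc
        _ < _ := hJ
    exact_mod_cast (lt_of_mul_lt_mul_right h3 (by positivity)).le
  -- Each small cube gets a large cube of its own, so the moved pieces stay disjoint.
  obtain ⟨f⟩ : Nonempty (I ↪ J) := Function.Embedding.nonempty_of_card_le (by simpa using hIJ)
  choose q m hqm using fun k : I =>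
    exists_preimage_gridCube_subset hα hε hεt (k : Fin d → ℤ) (f k : Fin d → ℤ)
  have hsub : ∀ k : I, (fun x => x + ((q k : ℝ) • α + fun i => (m k i : ℝ))) ⁻¹'
      (R ∩ gridCube ε (k : Fin d → ℤ)) ⊆ gridCube (t * ε) (f k : Fin d → ℤ) := fun k =>
    (Set.preimage_mono Set.inter_subset_right).trans (hqm k)
  refine ⟨⋃ k ∈ (Finset.univ : Finset I), (fun x => x + ((q k : ℝ) • α + fun i => (m k i : ℝ))) ⁻¹'
      (R ∩ gridCube ε (k : Fin d → ℤ)),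
    Set.iUnion₂_subset fun k _ => (hsub k).trans (hJV _ (f k).2), ?_⟩
  have hRU : R = ⋃ k ∈ (Finset.univ : Finset I), R ∩ gridCube ε (k : Fin d → ℤ) := by
    refine Set.Subset.antisymm (fun x hx => ?_)
      (Set.iUnion₂_subset fun k _ => Set.inter_subset_left)
    obtain ⟨k, hk, hxk⟩ := Set.mem_iUnion₂.1 (hRI (subset_closure hx))
    exact Set.mem_iUnion₂.2 ⟨⟨k, hk⟩, Finset.mem_univ _, hx, hxk⟩
  have key := Equidiscrepant.biUnion (α := α) (Finset.univ : Finset I)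
    (fun k _ => Equidiscrepant.preimage_add (α := α)
      (hR.inter_of_null (isRiemannMeasurable_gridCube hε (k : Fin d → ℤ)).2) (q k) (m k))
    (fun k _ l _ hkl => ((pairwise_disjoint_gridCube ε) (Subtype.coe_injective.ne hkl)).mono
      Set.inter_subset_right Set.inter_subset_right)
    (fun k _ l _ hkl => ((pairwise_disjoint_gridCube (t * ε))
      (Subtype.coe_injective.ne (f.injective.ne hkl))).mono (hsub k) (hsub l))
  rwa [← hRU] at key

/-! ### A model set of volume `γ` with bounded discrepancy -/

/-- The linear form with integer coefficients `n`. -/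
def intForm (n : Fin d → ℤ) : (Fin d → ℝ) →ₗ[ℝ] ℝ := ∑ i, (n i : ℝ) • LinearMap.proj i

lemma intForm_apply (n : Fin d → ℤ) (x : Fin d → ℝ) : intForm n x = ∑ i, (n i : ℝ) * x i := by
  simp [intForm]

lemma fract_intForm_add_int (n : Fin d → ℤ) (x : Fin d → ℝ) (m : Fin d → ℤ) :
    Int.fract (intForm n (x + fun i => (m i : ℝ))) = Int.fract (intForm n x) := by
  have h : intForm n (fun i => (m i : ℝ)) = ((∑ i, n i * m i : ℤ) : ℝ) := by
    rw [intForm_apply]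
    push_cast
    rfl
  rw [map_add, h, Int.fract_add_intCast]

/-- For `n ≠ 0` the form is a surjective linear map, and such maps pull null sets back to null sets.
-/
lemma volume_intForm_preimage {n : Fin d → ℤ} (hn : n ≠ 0) {D : Set ℝ} (hD : D.Countable) :
    volume (intForm n ⁻¹' D) = 0 := by
  obtain ⟨i, hi⟩ := Function.ne_iff.1 hn
  have hi' : (n i : ℝ) ≠ 0 := by simpa using hi
  have hsurj : Function.Surjective (intForm n) := by
    intro y
    refine ⟨Pi.single i (y / n i), ?_⟩
    rw [intForm_apply, Finset.sum_eq_single i (fun j _ hj => by simp [hj]) (by simp)]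
    simp only [Pi.single_eq_same]
    field_simp
  have h := (ae_comp_linearMap_mem_iff (intForm n) volume volume hsurj
    hD.measurableSet.compl).2 (compl_mem_ae_iff.2 (hD.measure_zero volume))
  exact measure_mono_null (fun x hx => not_not_intro hx) (ae_iff.1 h)

/-- Away from the integers `Int.fract` is continuous, so a non-integer frontier point has fractional
part exactly `r`. -/
lemma frontier_fract_lt_countable (r : ℝ) : (frontier {y : ℝ | Int.fract y < r}).Countable := by
  refine ((Set.countable_range fun z : ℤ => (z : ℝ)).union
    (Set.countable_range fun z : ℤ => (z : ℝ) + r)).mono fun y hy => ?_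
  by_contra h
  rw [Set.mem_union, not_or, Set.mem_range, Set.mem_range] at h
  have h0 : y ≠ ⌊y⌋ := fun h0 => h.1 ⟨_, h0.symm⟩
  have hc : ContinuousAt (fun y : ℝ => Int.fract y) y := continuousAt_fract h0
  have hne : Int.fract y ≠ r := fun hr => h.2 ⟨⌊y⌋, by rw [← hr, Int.floor_add_fract]⟩
  rcases lt_or_gt_of_ne hne with hr | hr
  · exact hy.2 (mem_interior_iff_mem_nhds.2 (hc.eventually_lt_const hr))
  · have h1 : y ∈ interior {y : ℝ | Int.fract y < r}ᶜ := mem_interior_iff_mem_nhds.2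
      ((hc.eventually_const_lt hr).mono fun z hz => not_lt.2 (le_of_lt hz))
    rw [interior_compl] at h1
    exact h1 hy.1

/-- The set of points at which the fractional part of an integer form is less than `r`. -/
def strip (n : Fin d → ℤ) (r : ℝ) : Set (Fin d → ℝ) := {x | Int.fract (intForm n x) < r}

lemma continuous_intForm (n : Fin d → ℤ) : Continuous (intForm n) :=
  LinearMap.continuous_of_finiteDimensional _

lemma measurableSet_strip (n : Fin d → ℤ) (r : ℝ) : MeasurableSet (strip n r) :=
  measurableSet_lt (measurable_fract.comp (continuous_intForm n).measurable) measurable_const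

lemma volume_frontier_strip (n : Fin d → ℤ) (s : ℝ) (h : n = 0 → Int.fract s = 0) :
    volume (frontier (strip n (Int.fract s))) = 0 := by
  by_cases hn : n = 0
  · have : strip n (Int.fract s) = ∅ := by
      rw [h hn]
      exact Set.eq_empty_of_forall_notMem fun x (hx : Int.fract (intForm n x) < 0) =>
        (Int.fract_nonneg _).not_gt hx
    simp [this]
  · have hsub := (continuous_intForm n).frontier_preimage_subset
      {y : ℝ | Int.fract y < Int.fract s}
    exact measure_mono_null hsub (volume_intForm_preimage hn (frontier_fract_lt_countable _))

/-- Up to its mean, the indicator is a difference of one function at `y - s` and at `y`. When `s` is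
congruent modulo 1 to the value of the form at `α`, this is a coboundary and its orbit sums
telescope. -/
lemma indicator_fract_lt (y s : ℝ) :
    {y : ℝ | Int.fract y < Int.fract s}.indicator (fun _ => (1 : ℝ)) y =
      Int.fract s + (Int.fract (y - s) - Int.fract y) := by
  have hy := Int.fract_nonneg y
  have hy1 := Int.fract_lt_one y
  have hs := Int.fract_nonneg s
  have hs1 := Int.fract_lt_one s
  have ey := Int.floor_add_fract y
  have es := Int.floor_add_fract s
  by_cases h : Int.fract y < Int.fract s
  · rw [Set.indicator_of_mem (by exact h)]
    have : Int.fract (y - s) = Int.fract y - Int.fract s + 1 :=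
      Int.fract_eq_iff.2 ⟨by linarith, by linarith, ⌊y⌋ - ⌊s⌋ - 1, by push_cast; linarith⟩
    rw [this]
    ring
  · rw [Set.indicator_of_notMem (by exact h)]
    have : Int.fract (y - s) = Int.fract y - Int.fract s :=
      Int.fract_eq_iff.2 ⟨by linarith, by linarith, ⌊y⌋ - ⌊s⌋, by push_cast; linarith⟩
    rw [this]
    ring

lemma indicator_strip (n : Fin d → ℤ) (s : ℝ) (x : Fin d → ℝ) :
    (strip n (Int.fract s)).indicator (fun _ => (1 : ℝ)) x =
      Int.fract s + (Int.fract (intForm n x - s) - Int.fract (intForm n x)) :=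
  indicator_fract_lt (intForm n x) s

/-- A unit grid cube contains exactly one integer translate of each point. -/
lemma torusMultiplicity_gridCube_inter {P : Set (Fin d → ℝ)}
    (hP : ∀ (x : Fin d → ℝ) (m : Fin d → ℤ), (x + fun i => (m i : ℝ)) ∈ P ↔ x ∈ P)
    (l : Fin d → ℤ) (x : Fin d → ℝ) :
    torusMultiplicity (gridCube 1 l ∩ P) x = P.indicator (fun _ => (1 : ℝ)) x := by
  classical
  have hmem : ∀ k : Fin d → ℤ, (x + fun i => (k i : ℝ)) ∈ gridCube 1 l ↔
      k = fun i => l i - ⌊x i⌋ := by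
    intro k
    rw [funext_iff]
    refine forall_congr' fun i => ?_
    rw [Pi.add_apply, div_one, Int.floor_add_intCast]
    constructor <;> intro h <;> linarith
  rw [torusMultiplicity_eq_sum (F := {fun i => l i - ⌊x i⌋}) fun k hk hx =>
    hk (Finset.mem_singleton.2 ((hmem k).1 hx.1)), Finset.sum_singleton]
  by_cases hx : x ∈ P
  · have h : (x + fun i => ((l i - ⌊x i⌋ : ℤ) : ℝ)) ∈ gridCube 1 l ∩ P :=
      ⟨(hmem _).2 rfl, (hP _ _).2 hx⟩
    rw [Set.indicator_of_mem hx, Set.indicator_of_mem h]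
  · have h : (x + fun i => ((l i - ⌊x i⌋ : ℤ) : ℝ)) ∉ gridCube 1 l ∩ P :=
      fun h => hx ((hP _ _).1 h.2)
    rw [Set.indicator_of_notMem hx, Set.indicator_of_notMem h]

lemma torusMultiplicity_gridCube (l : Fin d → ℤ) (x : Fin d → ℝ) :
    torusMultiplicity (gridCube 1 l) x = 1 := by
  have := torusMultiplicity_gridCube_inter (P := Set.univ) (fun _ _ => Iff.rfl) l x
  simpa using this

lemma torusMultiplicity_biUnion_gridCube (I : Finset (Fin d → ℤ)) (x : Fin d → ℝ) :
    torusMultiplicity (⋃ k ∈ I, gridCube 1 k) x = I.card := by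
  classical
  induction I using Finset.induction_on with
  | empty => simp [torusMultiplicity]
  | insert k I hk ih =>
    rw [Finset.set_biUnion_insert, torusMultiplicity_union
      (isRiemannMeasurable_gridCube one_pos k).1
      (IsRiemannMeasurable.biUnion I fun l _ => isRiemannMeasurable_gridCube one_pos l).1, ih,
      torusMultiplicity_gridCube, Finset.card_insert_of_notMem hk]
    · push_cast
      ring
    · rw [Set.disjoint_iUnion₂_right]
      exact fun l hl => pairwise_disjoint_gridCube 1 (by rintro rfl; exact hk hl)

lemma torusMultiplicity_gridCube_inter_strip (n : Fin d → ℤ) (s : ℝ) (l : Fin d → ℤ)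
    (x : Fin d → ℝ) : torusMultiplicity (gridCube 1 l ∩ strip n (Int.fract s)) x =
      Int.fract s + (Int.fract (intForm n x - s) - Int.fract (intForm n x)) := by
  rw [torusMultiplicity_gridCube_inter, indicator_strip]
  intro y m
  simp only [strip, Set.mem_ofPred_eq, fract_intForm_add_int]

lemma abs_visits_strip_le (n : Fin d → ℤ) {s : ℝ} {n₀ : ℤ} (hs : s = n₀ + intForm n α)
    (l : Fin d → ℤ) (N : ℕ) (x : Fin d → ℝ) :
    |visits α (gridCube 1 l ∩ strip n (Int.fract s)) N x - N * Int.fract s| ≤ 1 := by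
  have h : visits α (gridCube 1 l ∩ strip n (Int.fract s)) N x = N * Int.fract s +
      (Int.fract (intForm n x - intForm n α) -
        Int.fract (intForm n x + N * intForm n α - intForm n α)) := by
    -- The extra `- intForm n α` makes the `k`-th term the value one orbit step earlier, as in the
    -- indicator identity.
    have hsum := Finset.sum_range_sub' (fun k : ℕ =>
      Int.fract (intForm n x + k * intForm n α - intForm n α)) N
    simp only [Nat.cast_zero, zero_mul, add_zero] at hsum
    rw [← hsum, visits, ← nsmul_eq_mul, ← Finset.card_range N, ← Finset.sum_const,
      Finset.card_range, ← Finset.sum_add_distrib]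
    refine Finset.sum_congr rfl fun k _ => ?_
    rw [torusMultiplicity_gridCube_inter_strip, map_add, map_smul, smul_eq_mul]
    congr 2
    · rw [hs, add_comm (n₀ : ℝ), ← sub_sub, Int.fract_sub_intCast]
    · congr 1
      push_cast
      ring
  rw [h, add_sub_cancel_left, abs_le]
  have h1 := Int.fract_nonneg (intForm n x - intForm n α)
  have h2 := Int.fract_lt_one (intForm n x - intForm n α)
  have h3 := Int.fract_nonneg (intForm n x + N * intForm n α - intForm n α)
  have h4 := Int.fract_lt_one (intForm n x + N * intForm n α - intForm n α)
  constructor <;> linarith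

/-- The integral of a `ℤ^d`-periodic function over the unit cube is invariant under translation. -/
lemma setIntegral_gridCube_add (g : (Fin d → ℝ) → ℝ)
    (hg : ∀ (x : Fin d → ℝ) (m : Fin d → ℤ), g (x + fun i => (m i : ℝ)) = g x)
    (a : Fin d → ℝ) :
    ∫ x in gridCube 1 0, g (a + x) = ∫ x in gridCube 1 0, g x := by
  have hF : gridCube 1 0 = ZSpan.fundamentalDomain (Pi.basisFun ℝ (Fin d)) := by
    rw [ZSpan.fundamentalDomain_pi_basisFun, gridCube_eq_pi one_pos]
    simp
  have h1 := ZSpan.isAddFundamentalDomain' (Pi.basisFun ℝ (Fin d)) volume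
  rw [← hF] at h1
  -- The cube and its translate are both fundamental domains for `ℤ^d`, so a periodic function has
  -- the same integral over each.
  have h2 := h1.vadd_of_comm a
  have : Countable (Submodule.span ℤ (Set.range (Pi.basisFun ℝ (Fin d)))).toAddSubgroup :=
    inferInstanceAs (Countable (Submodule.span ℤ (Set.range (Pi.basisFun ℝ (Fin d)))))
  refine Eq.trans ?_ (h1.setIntegral_eq h2 (f := g) ?_).symm
  · exact ((measurePreserving_add_left volume a).setIntegral_image_emb
      (measurableEmbedding_addLeft a) g (gridCube 1 0)).symm
  · rintro ⟨v, hv⟩ x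
    change g (v + x) = g x
    rw [Submodule.mem_toAddSubgroup, Module.Basis.mem_span_iff_repr_mem] at hv
    choose m hm using hv
    have : v = fun i => (m i : ℝ) := by
      ext i
      simpa using (hm i).symm
    rw [add_comm, this, hg]

/-- Integrate the indicator identity over the unit cube: modulo 1, subtracting `s` from the form is
translation by `-α`, so the two fractional-part integrals cancel. -/
lemma volume_gridCube_inter_strip (n : Fin d → ℤ) {s : ℝ} {n₀ : ℤ} (hs : s = n₀ + intForm n α) :
    volume (gridCube 1 0 ∩ strip n (Int.fract s)) = ENNReal.ofReal (Int.fract s) := by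
  have hvol : volume (gridCube 1 (0 : Fin d → ℤ)) = 1 := by simp [volume_gridCube one_pos]
  have hfin : volume (gridCube 1 0 ∩ strip n (Int.fract s)) ≠ ⊤ :=
    ((measure_mono Set.inter_subset_left).trans_lt (hvol.trans_lt ENNReal.one_lt_top)).ne
  have hint : ∀ a : ℝ, IntegrableOn (fun x => Int.fract (intForm n x - a))
      (gridCube 1 (0 : Fin d → ℤ)) := fun a =>
    Measure.integrableOn_of_bounded (M := 1) (by rw [hvol]; exact ENNReal.one_ne_top)
      (measurable_fract.comp
        ((continuous_intForm n).measurable.sub_const a)).aestronglyMeasurable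
      (Filter.Eventually.of_forall fun x => by
        rw [Real.norm_eq_abs, abs_of_nonneg (Int.fract_nonneg _)]
        exact (Int.fract_lt_one _).le)
  have h1 : (volume (gridCube 1 0 ∩ strip n (Int.fract s))).toReal = Int.fract s := by
    calc (volume (gridCube 1 0 ∩ strip n (Int.fract s))).toReal
        = ∫ x in gridCube 1 0, (strip n (Int.fract s)).indicator (fun _ => (1 : ℝ)) x := by
          rw [integral_indicator_const _ (measurableSet_strip n _), measureReal_restrict_apply
            (measurableSet_strip n _), Set.inter_comm]
          simp [measureReal_def]
      _ = ∫ x in gridCube 1 0,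
            (Int.fract s + (Int.fract (intForm n x - s) - Int.fract (intForm n x - 0))) := by
          simp only [indicator_strip, sub_zero]
      _ = Int.fract s + ((∫ x in gridCube 1 0, Int.fract (intForm n x - s)) -
            ∫ x in gridCube 1 0, Int.fract (intForm n x - 0)) := by
          have hc : IntegrableOn (fun _ : Fin d → ℝ => Int.fract s) (gridCube 1 0) :=
            integrableOn_const (by simp [hvol])
          have hsub : IntegrableOn (fun x => Int.fract (intForm n x - s) -
              Int.fract (intForm n x - 0)) (gridCube 1 0) := (hint s).sub (hint 0)
          rw [integral_add hc hsub,
            integral_sub (hint s) (hint 0)]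
          simp [measureReal_def, hvol]
      _ = Int.fract s := by
          have h2 := setIntegral_gridCube_add (fun x => Int.fract (intForm n x))
            (fun x m => fract_intForm_add_int n x m) (-α)
          have h3 : ∀ x, Int.fract (intForm n (-α + x)) = Int.fract (intForm n x - s) := by
            intro x
            rw [hs, add_comm (n₀ : ℝ), ← sub_sub, Int.fract_sub_intCast, map_add, map_neg,
              neg_add_eq_sub]
          simp only [h3] at h2
          rw [h2]
          simp
  rw [← ENNReal.ofReal_toReal hfin, h1]

/-- Every positive number in `ℤ + ℤ α₁ + ⋯ + ℤ α_d` is the volume of a Riemann measurable bounded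
remainder set. -/
theorem exists_visits_sub_le (hd : 0 < d) {γ : ℝ} (hγ : 0 < γ) {n₀ : ℤ} {n : Fin d → ℤ}
    (hn : γ = n₀ + intForm n α) :
    ∃ T : Set (Fin d → ℝ), IsRiemannMeasurable T ∧ volume T = ENNReal.ofReal γ ∧
      ∃ C, ∀ N x, |visits α T N x - N * γ| ≤ C := by
  have : Nonempty (Fin d) := ⟨⟨0, hd⟩⟩
  -- Cube 0 is reserved for the strip of volume `Int.fract γ`; for `d > 0` there are infinitely many
  -- other cubes to supply the integer part.
  obtain ⟨I, hI, hcard⟩ :=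
    (Set.finite_singleton (0 : Fin d → ℤ)).infinite_compl.exists_subset_card_eq ⌊γ⌋₊
  have hγI : γ = Int.fract γ + I.card := by
    rw [hcard, natCast_floor_eq_intCast_floor hγ.le, Int.fract_add_floor]
  have hQ : IsRiemannMeasurable (gridCube 1 0 ∩ strip n (Int.fract γ)) :=
    (isRiemannMeasurable_gridCube one_pos 0).inter_of_null
      (volume_frontier_strip n γ fun h => by
        rw [hn, h, intForm_apply]
        simp)
  have hJ : IsRiemannMeasurable (⋃ k ∈ I, gridCube 1 k) :=
    IsRiemannMeasurable.biUnion I fun k _ => isRiemannMeasurable_gridCube one_pos k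
  have hdisj : Disjoint (gridCube 1 0 ∩ strip n (Int.fract γ)) (⋃ k ∈ I, gridCube 1 k) := by
    rw [Set.disjoint_iUnion₂_right]
    exact fun k hk => (pairwise_disjoint_gridCube 1 (Ne.symm (hI hk))).mono_left
      Set.inter_subset_left
  refine ⟨_, hQ.union hJ, ?_, 1, fun N x => ?_⟩
  · rw [measure_union₀ hJ.nullMeasurableSet hdisj.aedisjoint, volume_gridCube_inter_strip n hn,
      volume_biUnion_gridCube one_pos, ← ENNReal.ofReal_add (Int.fract_nonneg _)
        (mul_nonneg (Nat.cast_nonneg _) (pow_nonneg zero_le_one _))]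
    congr 1
    rw [one_pow, mul_one, ← hγI]
  -- Whole unit cubes have no discrepancy, so the strip alone accounts for the bound 1.
  · have h1 : visits α (⋃ k ∈ I, gridCube 1 k) N x = N * I.card := by
      simp [visits, torusMultiplicity_biUnion_gridCube]
    have h2 : visits α (gridCube 1 0 ∩ strip n (Int.fract γ)) N x + N * I.card - N * γ =
        visits α (gridCube 1 0 ∩ strip n (Int.fract γ)) N x - N * Int.fract γ := by
      linear_combination (-(N : ℝ)) * hγI
    rw [visits_union hQ.1 hJ.1 hdisj, h1, h2]
    exact abs_visits_strip_le n hn 0 N x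

/-! ### Construction of the set between `K` and `U` -/

/-- Having the closure inside `U` makes `U \ closure A` an open set of volume `volume U - volume A`,
where the rest of the model set can be placed. -/
lemma exists_isRiemannMeasurable_between {d : ℕ} {K U : Set (Fin d → ℝ)} (hK : IsCompact K)
    (hU : IsOpen U) (hKU : K ⊆ U) {c : ENNReal} (hc : volume K < c) :
    ∃ A, IsRiemannMeasurable A ∧ K ⊆ A ∧ closure A ⊆ U ∧ volume A < c := by
  obtain ⟨W, hKW, hW, hWc⟩ := K.exists_isOpen_lt_of_lt c hc
  obtain ⟨V, hV, hKV, hVU, -⟩ := exists_open_between_and_isCompact_closure hK (hU.inter hW)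
    (Set.subset_inter hKU hKW)
  obtain ⟨δ, hδ, h⟩ := exists_gridCube_cover hK hV hKV
  obtain ⟨ε, hε, hεδ⟩ := exists_between hδ
  obtain ⟨I, hKI, hIV⟩ := h ε hε hεδ
  have hAV : ⋃ k ∈ I, gridCube ε k ⊆ V := Set.iUnion₂_subset hIV
  have hcl := (closure_mono hAV).trans hVU
  exact ⟨_, IsRiemannMeasurable.biUnion I fun k _ => isRiemannMeasurable_gridCube hε k, hKI,
    hcl.trans Set.inter_subset_left,
    (measure_mono ((subset_closure.trans hcl).trans Set.inter_subset_right)).trans_lt hWc⟩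

/-- A Riemann measurable bounded remainder set of prescribed volume `γ ∈ ℤ + ℤ α₁ + ⋯ + ℤ α_d` can be
found between a compact set and an open set. -/
theorem exists_isBoundedRemainderSet_between (d : ℕ) (α : Fin d → ℝ)
    (hα : LinearIndependent ℚ (Fin.cons 1 α : Fin (d + 1) → ℝ))
    (γ : ℝ) (hγ_pos : 0 < γ)
    (hγ : ∃ (n₀ : ℤ) (n : Fin d → ℤ), γ = n₀ + ∑ i, (n i : ℝ) * α i)
    (K U : Set (Fin d → ℝ)) (hK : IsCompact K) (hU : IsOpen U) (hKU : K ⊆ U)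
    (hKγ : volume K < ENNReal.ofReal γ) (hγU : ENNReal.ofReal γ < volume U) :
    ∃ S : Set (Fin d → ℝ),
      IsRiemannMeasurable S ∧
      IsBoundedRemainderSet α S ∧
      K ⊆ S ∧ S ⊆ U ∧ volume S = ENNReal.ofReal γ := by
  obtain ⟨n₀, n, hγ⟩ := hγ
  rw [← intForm_apply] at hγ
  -- In dimension 0 the space is a point of mass 1, which would force the integer `γ` strictly
  -- between 0 and 1.
  have hd : 0 < d := by
    by_contra h
    obtain rfl : d = 0 := by omega
    have h1 : volume U ≤ 1 :=
      (measure_mono (Set.subset_univ U)).trans (by simp [volume_pi])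
    have h2 : γ < 1 := by
      rw [← ENNReal.ofReal_lt_ofReal_iff one_pos, ENNReal.ofReal_one]
      exact hγU.trans_le h1
    rw [intForm_apply, Finset.univ_eq_empty, Finset.sum_empty, add_zero] at hγ
    rw [hγ] at hγ_pos h2
    have h3 : 0 < n₀ := by exact_mod_cast hγ_pos
    have h4 : n₀ < 1 := by exact_mod_cast h2
    omega
  obtain ⟨T, hT, hTγ, C, hC⟩ := exists_visits_sub_le hd hγ_pos hγ
  obtain ⟨A, hA, hKA, hAU, hAγ⟩ := exists_isRiemannMeasurable_between hK hU hKU hKγ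
  -- The target must be open; passing to the interior of `T` loses no volume.
  obtain ⟨A', hA'T, hAA'⟩ := exists_equidiscrepant_subset hα hA isOpen_interior
    (hAγ.trans_eq (by rw [hT.volume_interior, hTγ]))
  have hA'T : A' ⊆ T := hA'T.trans interior_subset
  have hAfin := hA.volume_ne_top
  have hvol : volume (T \ A') < volume (U \ closure A) := by
    rw [measure_sdiff hA'T hAA'.right.nullMeasurableSet hAA'.right.volume_ne_top, hTγ,
      ← hAA'.volume_eq, measure_sdiff hAU isClosed_closure.nullMeasurableSet
        (by rwa [hA.volume_closure]), hA.volume_closure]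
    exact (ENNReal.sub_lt_iff_lt_right hAfin hAγ.le).2
      (by rwa [tsub_add_cancel_of_le (hAγ.le.trans hγU.le)])
  obtain ⟨R, hRU, hR⟩ := exists_equidiscrepant_subset hα (hT.diff hAA'.right)
    (hU.sdiff isClosed_closure) hvol
  have hdisj : Disjoint A R := Set.disjoint_left.2 fun x hx hxR => (hRU hxR).2 (subset_closure hx)
  -- The decomposition `T = A' ∪ (T \ A')` is matched piece by piece with `A ∪ R`.
  have key := hAA'.symm.union hR Set.disjoint_sdiff_right hdisj
  rw [Set.union_sdiff_cancel hA'T] at key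
  refine ⟨A ∪ R, key.right, key.isBoundedRemainderSet (C := C) fun N x => ?_,
    hKA.trans Set.subset_union_left, Set.union_subset (subset_closure.trans hAU)
      fun x hx => (hRU hx).1, by rw [← key.volume_eq, hTγ]⟩
  rw [hTγ, ENNReal.toReal_ofReal hγ_pos.le]
  exact hC N x

end

end BoundedRemainder

theorem mainTheorem6 (d : ℕ) (α : Fin d → ℝ)
    (hα : LinearIndependent ℚ (Fin.cons 1 α : Fin (d + 1) → ℝ))
    (γ : ℝ) (hγ_pos : 0 < γ)
    (hγ : ∃ (n₀ : ℤ) (n : Fin d → ℤ), γ = n₀ + ∑ i, (n i : ℝ) * α i)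
    (K U : Set (Fin d → ℝ)) (hK : IsCompact K) (hU : IsOpen U) (hKU : K ⊆ U)
    (hKγ : volume K < ENNReal.ofReal γ) (hγU : ENNReal.ofReal γ < volume U) :
    ∃ S : Set (Fin d → ℝ),
      BoundedRemainder.IsRiemannMeasurable S ∧
      BoundedRemainder.IsBoundedRemainderSet α S ∧
      K ⊆ S ∧ S ⊆ U ∧ volume S = ENNReal.ofReal γ :=
  BoundedRemainder.exists_isBoundedRemainderSet_between d α hα γ hγ_pos hγ K U hK hU hKU hKγ hγU
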